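/- Let $\gamma>1$, $\theta=\frac{\gamma-1}{2}$, $\kappa=\theta^2/\gamma$, let $\mathbb T=\mathbb R/L\mathbb Z$ ($L>0$), and let $\lambda$ be Lebesgue measure on $[0,\infty)\times\mathbb T$. **The state space.** Let $S=\{z\in[0,\infty)\times\mathbb R:|z|=1\}$, and let $C_b(\overline{\mathcal H})$ be the set of continuous functions $f:[0,\infty)\times\mathbb R\to\mathbb R$ of $(\rho,u)$ that are constant on the vacuum set $\{\rho=0\}$ and for which $f_\infty(z)=\lim_{r\to\infty}f(rz)$ exists uniformly in $z\in S$ and is continuous on $S$. Let $\overline{\mathcal H}$ be the compactification of $(0,\infty)\times\mathbb R$ whose points are the states $(\rho,u)$ with $\rho>0$, the points at infinity in the directions $z=(z_1,z_2)\in S$ with $z_1>0$, and one further point $V$ that represents all vacuum states $(0,u)$ and the two directions $(0,\pm1)$ at infinity. Each $f\in C_b(\overline{\mathcal H})$ is regarded as a function on $\overline{\mathcal H}$, with the value $f_\infty(z)$ at the point at infinity in direction $z$ and the value $f(0,0)$ at $V$; $\overline{\mathcal H}$ carries the coarsest topology that makes all these functions continuous. The energy is $\eta_E(\rho,u)=\frac12\rho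 u^2+\frac{\kappa}{\gamma-1}\rho^\gamma$, with $\eta_E(V)=0$ and $\eta_E=+\infty$ (its limit) at the points at infinity in directions with $z_1>0$. **Young measures.** Let $\mathcal V$ be the set of maps $\nu:[0,\infty)\times\mathbb T\to\mathcal P(\overline{\mathcal H})$, identified when they agree $\lambda$-a.e., such that $(t,x)\mapsto\langle\varphi,\nu_{t,x}\rangle=\int_{\overline{\mathcal H}}\varphi\,d\nu_{t,x}$ is measurable for all $\varphi\in C_b(\overline{\mathcal H})$. The vague topology on $\mathcal V$ is the coarsest one for which $\nu\mapsto\int\psi(t,x)\langle\varphi,\nu_{t,x}\rangle\,d\lambda(t,x)$ is continuous for all $\psi\in C_c^\infty([0,\infty)\times\mathbb T)$ and $\varphi\in C_b(\overline{\mathcal H})$. A random Young measure is a measurable map from a probability space into $\mathcal V$ with its Borel $\sigma$-algebra. **Theorem.** 1. For every sequence $(C_m)_{m\ge1}$ of nonnegative constants, the set $$\bigcap_{m=1}^\infty\Big\{\nu\in\mathcal V:\int_{[0,m]\times\mathbb T}\langle\eta_E,\nu_{t,x}\rangle\,d\lambda(t,x)\le C_m\Big\}$$ is compact in $\mathcal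 V$. 2. Let $(\nu_i)_{i\in I}$ be a family (for example a sequence) of random Young measures on a probability space $(\Omega,\mathcal F,\mathbb P)$, and let $(\alpha_m)_{m\ge1}$ be nonnegative constants such that $$\mathbb E\int_{[0,m]\times\mathbb T}\langle\eta_E,(\nu_i)_{t,x}\rangle\,d\lambda(t,x)\le\alpha_m\qquad\text{for all } m\ge1,\ i\in I .$$ Then the laws of the $\nu_i$ are tight in $\mathcal V$: for every $\varepsilon>0$ there is a compact set $K\subset\mathcal V$ with $\mathbb P(\nu_i\notin K)\le\varepsilon$ for all $i\in I$. -/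

import Mathlib

open MeasureTheory Filter
open scoped NNReal ENNReal ContDiff

noncomputable section

namespace VacuumYoung

/-- The closed half circle `S¹ ∩ ([0, ∞) × ℝ)` of directions in the `(ρ, u)` half plane. -/
abbrev HalfCircle : Type := {z : ℝ≥0 × ℝ // (z.1 : ℝ) ^ 2 + z.2 ^ 2 = 1}

/-- The test class `C_b(H̄)`: continuous functions `f` of `(ρ, u) ∈ [0, ∞) × ℝ` that are constant on
the vacuum set `{ρ = 0}` and whose radial limits `f_∞(z) = lim_{r → ∞} f (r z)` exist, uniformly in
the direction `z`, and form a continuous function on the closed half circle.  The field `fInf` is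
determined by `f`.  Such an `f` is bounded. -/
structure CbH where
  f : ℝ≥0 × ℝ → ℝ
  fInf : HalfCircle → ℝ
  continuous_f : Continuous f
  vacuum : ∀ u v : ℝ, f (0, u) = f (0, v)
  continuous_fInf : Continuous fInf
  radial_limit :
    TendstoUniformly (fun (r : ℝ≥0) (z : HalfCircle) => f (r * z.1.1, (r : ℝ) * z.1.2)) fInf atTop

/-- The points of the compactification `H̄` of `H = (0, ∞) × ℝ`: all vacuum states are one point
`vac`; `state ρ u` is a state of positive density; `infty z` is the point at infinity in a
direction `z` of the half circle with positive first coordinate (the two directions with first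
coordinate `0` are limits of vacuum states and belong to the point `vac`). -/
inductive HBar : Type
  | vac : HBar
  | state (ρ : ℝ≥0) (u : ℝ) (hρ : 0 < ρ) : HBar
  | infty (z : HalfCircle) (hz : 0 < z.1.1) : HBar

/-- A function of the class `C_b(H̄)`, as a function on `H̄`. -/
def CbH.eval (φ : CbH) : HBar → ℝ
  | .vac => φ.f (0, 0)
  | .state ρ u _ => φ.f (ρ, u)
  | .infty z _ => φ.fInf z

/-- The topology of `H̄`: `x_n → x` iff `φ x_n → φ x` for all `φ ∈ C_b(H̄)`. -/
instance : TopologicalSpace HBar := ⨅ φ : CbH, TopologicalSpace.induced φ.eval inferInstance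

instance : MeasurableSpace HBar := borel HBar

instance : BorelSpace HBar := ⟨rfl⟩

/-- The pressure constant `κ = θ² / γ`, `θ = (γ - 1) / 2`. -/
def kappa (γ : ℝ) : ℝ := ((γ - 1) / 2) ^ 2 / γ

/-- The energy `η_E(ρ, u) = ρ u² / 2 + κ / (γ - 1) ρ ^ γ` on `H̄`.  It vanishes in the vacuum, and at
the points at infinity it takes the value `∞`, its limit there. -/
def energyDensity (γ : ℝ) : HBar → ℝ≥0∞
  | .vac => 0
  | .state ρ u _ =>
      ENNReal.ofReal (1 / 2 * (ρ : ℝ) * u ^ 2 + kappa γ / (γ - 1) * (ρ : ℝ) ^ γ)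
  | .infty _ _ => ⊤

/-- Space-time `[0, ∞) × 𝕋`, for the torus `𝕋 = ℝ / L ℤ`. -/
abbrev SpaceTime (L : ℝ) : Type := ℝ≥0 × AddCircle L

/-- `ψ ∈ C_c^∞([0, ∞) × 𝕋)`: compact support, and smooth up to the boundary `t = 0` when lifted to a
function on `[0, ∞) × ℝ` that is `L`-periodic in the second variable. -/
def IsTest {L : ℝ} (ψ : SpaceTime L → ℝ) : Prop :=
  HasCompactSupport ψ ∧
    ContDiffOn ℝ ∞ (fun p : ℝ × ℝ => ψ (p.1.toNNReal, (p.2 : AddCircle L)))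
      (Set.Ici 0 ×ˢ Set.univ)

variable (L : ℝ) [Fact (0 < L)]

/-- Lebesgue measure `λ` on `[0, ∞) × 𝕋`: the product of the restriction of Lebesgue measure to
`[0, ∞)` and of the translation invariant measure of total mass `L` on `𝕋`. -/
def lam : Measure (SpaceTime L) :=
  (Measure.comap ((↑) : ℝ≥0 → ℝ) volume).prod (volume : Measure (AddCircle L))

/-- A weakly-star measurable map from space-time to the probability measures on `H̄`. -/
structure YoungMap where
  toFun : SpaceTime L → ProbabilityMeasure HBar
  measurable_pairing :
    ∀ φ : CbH, Measurable fun z => ∫ p, φ.eval p ∂(toFun z : Measure HBar)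

/-- Equality almost everywhere in space-time. -/
instance YoungMap.setoid : Setoid (YoungMap L) where
  r ν μ := ν.toFun =ᵐ[lam L] μ.toFun
  iseqv := ⟨fun _ => Filter.EventuallyEq.rfl, fun h => h.symm, fun h k => h.trans k⟩

/-- The space `𝒱` of Young measures on `[0, ∞) × 𝕋` with values in `𝒫(H̄)`; as usual, two of them
that agree almost everywhere are identified. -/
def YoungMeasure : Type := Quotient (YoungMap.setoid L)

variable {L}

/-- The pairing `∫ ψ(t, x) ⟨φ, ν_{t,x}⟩ dλ(t, x)`. -/
def YoungMeasure.pairing (ψ : SpaceTime L → ℝ) (φ : CbH) (ν : YoungMeasure L) : ℝ :=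
  Quotient.lift
    (fun ν : YoungMap L => ∫ z, ψ z * ∫ p, φ.eval p ∂(ν.toFun z : Measure HBar) ∂(lam L))
    (fun _ _ h => integral_congr_ae (Filter.Eventually.mono h fun z hz => by simp only [hz])) ν

/-- The vague topology: the coarsest one for which all pairings with `ψ ∈ C_c^∞([0, ∞) × 𝕋)` and
`φ ∈ C_b(H̄)` are continuous. -/
instance : TopologicalSpace (YoungMeasure L) :=
  ⨅ (ψ : {ψ : SpaceTime L → ℝ // IsTest ψ}) (φ : CbH),
    TopologicalSpace.induced (YoungMeasure.pairing ψ.1 φ) inferInstance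

instance : MeasurableSpace (YoungMeasure L) := borel (YoungMeasure L)

instance : BorelSpace (YoungMeasure L) := ⟨rfl⟩

/-- The energy `∫_{[0, m] × 𝕋} ⟨η_E, ν_{t,x}⟩ dλ(t, x)`, a value in `[0, ∞]`. -/
def YoungMeasure.energy (γ : ℝ) (m : ℕ) (ν : YoungMeasure L) : ℝ≥0∞ :=
  Quotient.lift
    (fun ν : YoungMap L =>
      ∫⁻ z in {z : SpaceTime L | z.1 ≤ m},
        ∫⁻ p, energyDensity γ p ∂(ν.toFun z : Measure HBar) ∂(lam L))
    (fun _ _ h => lintegral_congr_ae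
      (Filter.Eventually.mono (ae_restrict_of_ae h) fun z hz => by simp only [hz])) ν

end VacuumYoung

end

/-!
The state space `H̄` is the closed half disc with the vertical axis collapsed to a point.  Polar
coordinates with radius in `[0, ∞]` map onto it, and they are continuous because radial limits are
uniform (`continuous_polar`); hence `H̄` is compact.  Two test functions embed it in the plane
(`isClosedEmbedding_planeEmbedding`), so that it is metrizable, and by compactness the test class is
all of `C(H̄)` (`CbH.ofContinuous`).

A Young measure `ν` is therefore a Markov kernel up to null sets.  After a change to the probability
measure `exp (-t) / L dt dx` on space-time, it amounts to a probability measure on space-time times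
`H̄` with this marginal.  Such measures form a closed set, which is tight because `H̄` is compact, and
so a compact set by Prokhorov's theorem.  Disintegration maps it onto the space of Young measures,
and it is continuous because a pairing `∫ ψ ⟨φ, ν⟩ dλ` is the integral of a bounded continuous
function of space-time and state (`continuous_disintegration`).  Thus the whole space of Young
measures is compact.

The energy density is discontinuous at the vacuum point, where `ρ u²` need not be small, but it is an
increasing limit of continuous functions, its minima with multiples of `ρ / (1 + |(ρ, u)|)`.
Together with smooth cutoffs in time they express the energy as a supremum of pairings
(`YoungMeasure.energy_eq_iSup`).  So the energy is lower semicontinuous, which makes the sets of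
bounded energy closed, hence compact.  It is then also measurable, and Chebyshev's inequality at each
time horizon yields tightness on such a set (`exists_energy_bound`).
-/

noncomputable section

namespace VacuumYoung

open Topology ProbabilityTheory BoundedContinuousFunction

/-! ### Polar coordinates and compactness of the state space -/

/-- The point of `H̄` that represents the state `(ρ, u)`; all vacuum states give `vac`. -/
def ofState (x : ℝ≥0 × ℝ) : HBar := if h : 0 < x.1 then .state x.1 x.2 h else .vac

/-- The point of `H̄` in which the ray with direction `z` ends; the two vertical directions
give `vac`. -/
def ofDirection (z : HalfCircle) : HBar := if h : 0 < z.1.1 then .infty z h else .vac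

/-- Polar coordinates on `H̄`: the radius ranges over `[0, ∞]` and the direction over the closed half
circle. -/
def polar (p : ℝ≥0∞ × HalfCircle) : HBar :=
  if p.1 = ⊤ then ofDirection p.2
  else ofState (p.1.toNNReal * p.2.1.1, (p.1.toNNReal : ℝ) * p.2.1.2)

lemma polar_top (z : HalfCircle) : polar (⊤, z) = ofDirection z := by simp [polar]

lemma polar_coe (r : ℝ≥0) (z : HalfCircle) :
    polar (r, z) = ofState (r * z.1.1, (r : ℝ) * z.1.2) := by simp [polar]

lemma eval_ofState (φ : CbH) (x : ℝ≥0 × ℝ) : φ.eval (ofState x) = φ.f x := by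
  obtain ⟨ρ, u⟩ := x
  rcases eq_or_ne ρ 0 with rfl | h
  · simpa [ofState, CbH.eval] using φ.vacuum 0 u
  · simp [ofState, CbH.eval, pos_iff_ne_zero, h]

/-- Along a vertical direction `f` is constant, so its limit is the value in the vacuum. -/
lemma CbH.fInf_of_vertical (φ : CbH) (z : HalfCircle) (hz : z.1.1 = 0) :
    φ.fInf z = φ.f (0, 0) := by
  refine tendsto_nhds_unique (φ.radial_limit.tendsto_at z) ?_
  refine tendsto_const_nhds.congr fun r => ?_
  rw [hz, mul_zero]
  exact φ.vacuum _ _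

lemma eval_ofDirection (φ : CbH) (z : HalfCircle) : φ.eval (ofDirection z) = φ.fInf z := by
  rcases eq_or_ne z.1.1 0 with h | h
  · simpa [ofDirection, CbH.eval, h] using (φ.fInf_of_vertical z h).symm
  · simp [ofDirection, CbH.eval, pos_iff_ne_zero, h]

lemma CbH.continuous_eval (φ : CbH) : Continuous φ.eval :=
  continuous_iInf_dom (i := φ) continuous_induced_dom

lemma continuous_hBar_iff {X : Type*} [TopologicalSpace X] {g : X → HBar} :
    Continuous g ↔ ∀ φ : CbH, Continuous fun x => φ.eval (g x) := by
  simp only [continuous_iInf_rng, continuous_induced_rng]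
  rfl

lemma continuous_ofState : Continuous ofState :=
  continuous_hBar_iff.2 fun φ => by simpa only [eval_ofState] using φ.continuous_f

lemma continuous_ofDirection : Continuous ofDirection :=
  continuous_hBar_iff.2 fun φ => by simpa only [eval_ofDirection] using φ.continuous_fInf

/-- Polar coordinates of the half plane are continuous where the radius is finite. -/
lemma continuousAt_ray (r : ℝ≥0∞) (hr : r ≠ ⊤) (z : HalfCircle) :
    ContinuousAt (fun p : ℝ≥0∞ × HalfCircle =>
      ((p.1.toNNReal * p.2.1.1, (p.1.toNNReal : ℝ) * p.2.1.2) : ℝ≥0 × ℝ)) (r, z) := by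
  have h1 : ContinuousAt (fun p : ℝ≥0∞ × HalfCircle => p.1.toNNReal) (r, z) :=
    (ENNReal.tendsto_toNNReal hr).comp continuousAt_fst
  have h2 : ContinuousAt (fun p : ℝ≥0∞ × HalfCircle => p.2.1) (r, z) := by fun_prop
  exact (h1.mul (continuousAt_fst.comp h2)).prodMk
    ((NNReal.continuous_coe.continuousAt.comp h1).mul (continuousAt_snd.comp h2))

lemma polar_eventuallyEq_ofState (r : ℝ≥0∞) (hr : r ≠ ⊤) (z : HalfCircle) :
    polar =ᶠ[𝓝 (r, z)] fun p => ofState (p.1.toNNReal * p.2.1.1, (p.1.toNNReal : ℝ) * p.2.1.2) := by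
  filter_upwards [continuousAt_fst.eventually_ne hr] with p hp
  simp [polar, hp]

lemma continuous_polar : Continuous polar := by
  rw [continuous_hBar_iff]
  refine fun φ => continuous_iff_continuousAt.2 fun ⟨r, z⟩ => ?_
  by_cases hr : r = ⊤
  · -- at infinity, split into the uniform radial convergence and the continuity of the limit
    subst hr
    rw [ContinuousAt, Metric.tendsto_nhds]
    intro ε hε
    have h1 : ∀ᶠ p : ℝ≥0∞ × HalfCircle in 𝓝 (⊤, z),
        ∀ w, dist (φ.fInf w) (φ.eval (polar (p.1, w))) < ε / 2 := by
      have h := Metric.tendstoUniformly_iff.1 φ.radial_limit (ε / 2) (by positivity)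
      obtain ⟨R, hR⟩ := eventually_atTop.1 h
      filter_upwards [continuousAt_fst.eventually (lt_mem_nhds (ENNReal.coe_lt_top (r := R)))]
        with p hp w
      by_cases hp' : p.1 = ⊤
      · rw [hp', polar_top, eval_ofDirection, dist_self]; positivity
      · lift p.1 to ℝ≥0 using hp' with s
        rw [polar_coe, eval_ofState]
        exact hR s (by exact_mod_cast hp.le) w
    have h2 : ∀ᶠ p : ℝ≥0∞ × HalfCircle in 𝓝 (⊤, z), dist (φ.fInf p.2) (φ.fInf z) < ε / 2 :=
      Metric.tendsto_nhds.1 ((φ.continuous_fInf.comp continuous_snd).tendsto (⊤, z)) _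
        (by positivity)
    filter_upwards [h1, h2] with p hp1 hp2
    have h3 := hp1 p.2
    rw [dist_comm] at h3
    rw [polar_top, eval_ofDirection]
    calc _ ≤ _ := dist_triangle _ (φ.fInf p.2) _
      _ < ε / 2 + ε / 2 := add_lt_add h3 hp2
      _ = ε := by ring
  · refine (((φ.continuous_f.continuousAt).comp (continuousAt_ray r hr z)).congr ?_)
    filter_upwards [polar_eventuallyEq_ofState r hr z] with p hp
    rw [hp, eval_ofState]
    rfl

/-- The Euclidean norm of a state. -/
def radius (x : ℝ≥0 × ℝ) : ℝ := √((x.1 : ℝ) ^ 2 + x.2 ^ 2)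

lemma continuous_radius : Continuous radius := by unfold radius; fun_prop

lemma radius_nonneg (x : ℝ≥0 × ℝ) : 0 ≤ radius x := Real.sqrt_nonneg _

lemma radius_sq (x : ℝ≥0 × ℝ) : radius x ^ 2 = (x.1 : ℝ) ^ 2 + x.2 ^ 2 :=
  Real.sq_sqrt (by positivity)

lemma radius_ray (r : ℝ≥0) (z : HalfCircle) : radius (r * z.1.1, (r : ℝ) * z.1.2) = r := by
  have h : (((r * z.1.1 : ℝ≥0) : ℝ)) ^ 2 + ((r : ℝ) * z.1.2) ^ 2 = (r : ℝ) ^ 2 := by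
    rw [NNReal.coe_mul, mul_pow, mul_pow, ← mul_add, z.2, mul_one]
  rw [radius, h, Real.sqrt_sq r.coe_nonneg]

lemma surjective_polar : Function.Surjective polar := by
  rintro (_ | ⟨ρ, u, hρ⟩ | ⟨z, hz⟩)
  · exact ⟨(⊤, ⟨(0, 1), by simp⟩), by simp [polar_top, ofDirection]⟩
  · have hsq := radius_sq (ρ, u)
    obtain ⟨R, hR⟩ : ∃ R : ℝ≥0, (R : ℝ) = radius (ρ, u) := ⟨⟨_, radius_nonneg _⟩, rfl⟩
    rw [← hR] at hsq
    have hR0 : R ≠ 0 := by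
      rintro rfl
      have : (0 : ℝ) < ρ := hρ
      simp only [NNReal.coe_zero] at hsq
      nlinarith [sq_nonneg u]
    have hR1 : (R : ℝ) ≠ 0 := NNReal.coe_ne_zero.2 hR0
    refine ⟨(R, ⟨(ρ / R, u / R), ?_⟩), ?_⟩
    · rw [NNReal.coe_div, div_pow, div_pow, ← add_div, ← hsq, div_self (pow_ne_zero 2 hR1)]
    · rw [polar_coe, mul_div_cancel₀ _ hR0, mul_div_cancel₀ _ hR1]
      simp [ofState, hρ]
  · exact ⟨(⊤, z), by simp [polar_top, ofDirection, hz]⟩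

instance : CompactSpace HalfCircle := by
  have hc : IsClosed {z : ℝ≥0 × ℝ | (z.1 : ℝ) ^ 2 + z.2 ^ 2 = 1} :=
    isClosed_eq (by fun_prop) continuous_const
  refine isCompact_iff_compactSpace.1 <|
    (isCompact_Icc.prod isCompact_Icc : IsCompact (Set.Icc (0 : ℝ≥0) 1 ×ˢ Set.Icc (-1 : ℝ) 1)
      ).of_isClosed_subset hc ?_
  intro z (hz : (z.1 : ℝ) ^ 2 + z.2 ^ 2 = 1)
  refine ⟨⟨zero_le, ?_⟩, ?_, ?_⟩
  · rw [← NNReal.coe_le_coe, NNReal.coe_one]; nlinarith [sq_nonneg z.2]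
  · nlinarith [sq_nonneg (z.1 : ℝ)]
  · nlinarith [sq_nonneg (z.1 : ℝ)]

instance : CompactSpace HBar :=
  ⟨by simpa [surjective_polar.range_eq] using isCompact_range continuous_polar⟩

/-! ### Separation and metrizability of the state space -/

/-- The coordinates of a point of `H̄` in the closed half disc, with `vac` in the origin. -/
def disc : HBar → ℝ × ℝ
  | .vac => (0, 0)
  | .state ρ u _ => (ρ / (1 + radius (ρ, u)), u / (1 + radius (ρ, u)))
  | .infty z _ => (z.1.1, z.1.2)

/-- A continuous function on the plane that is constant on the vertical axis gives, through the
coordinates in the half disc, a test function on `H̄`. -/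
def CbH.ofDisc (g : ℝ × ℝ → ℝ) (hg : Continuous g) (h0 : ∀ b, g (0, b) = g (0, 0)) : CbH where
  f x := g (x.1 / (1 + radius x), x.2 / (1 + radius x))
  fInf z := g (z.1.1, z.1.2)
  continuous_f := by
    have h (x) : 1 + radius x ≠ 0 := (add_pos_of_pos_of_nonneg one_pos (radius_nonneg x)).ne'
    have := continuous_radius
    fun_prop (disch := exact h _)
  vacuum u v := by simp [h0 (u / _), h0 (v / _)]
  continuous_fInf := by fun_prop
  radial_limit := by
    have hc : Continuous ↿(fun (s : ℝ) (z : HalfCircle) => g (s * z.1.1, s * z.1.2)) := by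
      change Continuous fun p : ℝ × HalfCircle => g (p.1 * p.2.1.1, p.1 * p.2.1.2)
      fun_prop
    have h1 : Tendsto (fun r : ℝ≥0 => (r : ℝ) / (1 + r)) atTop (𝓝 1) := by
      have h2 : Tendsto (fun r : ℝ≥0 => 1 - ((1 : ℝ) + r)⁻¹) atTop (𝓝 (1 - 0)) :=
        tendsto_const_nhds.sub <| tendsto_inv_atTop_zero.comp <|
          tendsto_atTop_add_const_left _ _ (NNReal.tendsto_coe_atTop.2 tendsto_id)
      rw [sub_zero] at h2
      refine h2.congr fun r => ?_
      have : (1 : ℝ) + r ≠ 0 := by positivity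
      field_simp
      ring
    have h2 := hc.tendstoUniformly _ 1
    intro U hU
    filter_upwards [h1.eventually (h2 U hU)] with r hr z
    have := hr z
    rw [radius_ray]
    simpa [div_mul_eq_mul_div] using this

lemma CbH.eval_ofDisc (g : ℝ × ℝ → ℝ) (hg : Continuous g) (h0 : ∀ b, g (0, b) = g (0, 0))
    (p : HBar) : (CbH.ofDisc g hg h0).eval p = g (disc p) := by
  cases p <;> simp [CbH.eval, CbH.ofDisc, disc]

lemma disc_fst_pos {p : HBar} (hp : p ≠ .vac) : 0 < (disc p).1 := by
  rcases p with _ | ⟨ρ, u, hρ⟩ | ⟨z, hz⟩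
  · exact absurd rfl hp
  · have := radius_nonneg (ρ, u)
    have : (0 : ℝ) < ρ := hρ
    simp only [disc]; positivity
  · exact hz

lemma injective_disc : Function.Injective disc := by
  have hstate (ρ u) (hρ : 0 < ρ) : (disc (.state ρ u hρ)).1 ^ 2 + (disc (.state ρ u hρ)).2 ^ 2 =
      (radius (ρ, u) / (1 + radius (ρ, u))) ^ 2 := by
    simp only [disc, div_pow, radius_sq, add_div]
  have hinf (z) (hz) : (disc (.infty z hz)).1 ^ 2 + (disc (.infty z hz)).2 ^ 2 = 1 := z.2
  have hlt (x) : (radius x / (1 + radius x)) ^ 2 < 1 := by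
    have := radius_nonneg x
    have h : radius x / (1 + radius x) < 1 := by rw [div_lt_one (by positivity)]; linarith
    exact pow_lt_one₀ (by positivity) h two_ne_zero
  intro p q h
  by_cases hp : p = .vac
  · by_contra hq
    have := disc_fst_pos (p := q) (fun h' => hq (hp.trans h'.symm))
    rw [← h, hp] at this
    exact lt_irrefl _ this
  by_cases hq : q = .vac
  · have := disc_fst_pos hp
    rw [h, hq] at this
    exact absurd this (lt_irrefl _)
  rcases p with _ | ⟨ρ, u, hρ⟩ | ⟨z, hz⟩
  · exact absurd rfl hp
  · rcases q with _ | ⟨ρ', u', hρ'⟩ | ⟨z', hz'⟩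
    · exact absurd rfl hq
    · have h1 := hstate ρ u hρ
      rw [h, hstate] at h1
      have hr := radius_nonneg (ρ, u)
      have hr' := radius_nonneg (ρ', u')
      rw [sq_eq_sq₀ (by positivity) (by positivity), div_eq_div_iff (by positivity)
        (by positivity)] at h1
      have h2 : radius (ρ', u') = radius (ρ, u) := by linarith
      simp only [disc, h2, Prod.mk.injEq] at h
      have h3 : 1 + radius (ρ, u) ≠ 0 := by positivity
      rw [div_left_inj' h3, div_left_inj' h3, NNReal.coe_inj] at h
      obtain ⟨rfl, rfl⟩ := h
      rfl
    · have h1 := hinf z' hz'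
      rw [← h, hstate] at h1
      exact absurd h1 (hlt _).ne
  · rcases q with _ | ⟨ρ', u', hρ'⟩ | ⟨z', hz'⟩
    · exact absurd rfl hq
    · have h1 := hinf z hz
      rw [h, hstate] at h1
      exact absurd h1 (hlt _).ne
    · simp only [disc, Prod.mk.injEq, NNReal.coe_inj] at h
      have : z = z' := Subtype.ext (Prod.ext h.1 h.2)
      subst this
      rfl

/-- The test function `ρ / (1 + |(ρ, u)|)`, which vanishes in the vacuum only. -/
def densityCoord : CbH := CbH.ofDisc Prod.fst continuous_fst fun _ => rfl

/-- The test function `ρ u / (1 + |(ρ, u)|) ^ 2`. -/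
def momentumCoord : CbH := CbH.ofDisc (fun x => x.1 * x.2) (by fun_prop) (by simp)

/-- An embedding of `H̄` into the plane: the product of the two coordinates in the half disc
collapses the vertical axis to the origin. -/
def planeEmbedding (p : HBar) : ℝ × ℝ := (densityCoord.eval p, momentumCoord.eval p)

lemma injective_planeEmbedding : Function.Injective planeEmbedding := by
  intro p q h
  simp only [planeEmbedding, densityCoord, momentumCoord, CbH.eval_ofDisc, Prod.mk.injEq] at h
  by_cases hp : p = .vac
  · by_contra hq
    have := disc_fst_pos (p := q) (fun h' => hq (hp.trans h'.symm))
    rw [← h.1, hp] at this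
    exact lt_irrefl _ this
  · obtain ⟨h1, h2⟩ := h
    rw [← h1] at h2
    exact injective_disc (Prod.ext h1 (mul_left_cancel₀ (disc_fst_pos hp).ne' h2))

lemma isClosedEmbedding_planeEmbedding : IsClosedEmbedding planeEmbedding :=
  ((densityCoord.continuous_eval).prodMk momentumCoord.continuous_eval).isClosedEmbedding
    injective_planeEmbedding

instance : PolishSpace HBar := isClosedEmbedding_planeEmbedding.polishSpace

instance : Nonempty HBar := ⟨.vac⟩

lemma isQuotientMap_polar : IsQuotientMap polar :=
  continuous_polar.isClosedMap.isQuotientMap continuous_polar surjective_polar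

/-- The test class consists of all continuous functions on `H̄`. -/
def CbH.ofContinuous (g : HBar → ℝ) (hg : Continuous g) : CbH where
  f x := g (ofState x)
  fInf z := g (ofDirection z)
  continuous_f := hg.comp continuous_ofState
  vacuum u v := by simp [ofState]
  continuous_fInf := hg.comp continuous_ofDirection
  radial_limit := by
    let _ : UniformSpace ℝ≥0∞ := uniformSpaceOfCompactR1
    have h := Continuous.tendstoUniformly
      (fun (r : ℝ≥0∞) (z : HalfCircle) => g (polar (r, z))) (hg.comp continuous_polar) ⊤
    simp only [polar_top] at h
    intro U hU
    filter_upwards [(ENNReal.tendsto_coe_nhds_top.2 tendsto_id).eventually (h U hU)] with r hr z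
    simpa only [id, polar_coe] using hr z

lemma CbH.eval_ofContinuous (g : HBar → ℝ) (hg : Continuous g) (p : HBar) :
    (CbH.ofContinuous g hg).eval p = g p := by
  cases p with
  | vac => simp [CbH.eval, CbH.ofContinuous, ofState]
  | state ρ u hρ => simp [CbH.eval, CbH.ofContinuous, ofState, hρ]
  | infty z hz => simp [CbH.eval, CbH.ofContinuous, ofDirection, hz]

/-! ### Continuous minorants of the energy density -/

lemma energyDensity_ofState {γ : ℝ} (hγ : 1 < γ) (x : ℝ≥0 × ℝ) :
    energyDensity γ (ofState x) = ENNReal.ofReal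
      (1 / 2 * (x.1 : ℝ) * x.2 ^ 2 + kappa γ / (γ - 1) * (x.1 : ℝ) ^ γ) := by
  obtain ⟨ρ, u⟩ := x
  rcases eq_or_ne ρ 0 with rfl | h
  · simp [ofState, energyDensity, Real.zero_rpow (by linarith : γ ≠ 0)]
  · simp [ofState, energyDensity, pos_iff_ne_zero, h]

lemma continuous_energyDensity_ofState {γ : ℝ} (hγ : 1 < γ) :
    Continuous fun x => energyDensity γ (ofState x) := by
  simp only [energyDensity_ofState hγ]
  have h : Continuous fun x : ℝ≥0 × ℝ => (x.1 : ℝ) ^ γ :=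
    (Real.continuous_rpow_const (by linarith)).comp (by fun_prop)
  exact ENNReal.continuous_ofReal.comp (by fun_prop)

/-- A lower bound by the internal energy, valid at the points at infinity as well. -/
lemma le_energyDensity_polar {γ : ℝ} (hγ : 1 < γ) (r : ℝ≥0∞) (z : HalfCircle) :
    ENNReal.ofReal (kappa γ / (γ - 1)) * (r * z.1.1) ^ γ ≤ energyDensity γ (polar (r, z)) := by
  have hγ0 : 0 < γ := by linarith
  have hγ1 : 0 < γ - 1 := by linarith
  by_cases hr : r = ⊤
  · subst hr
    rw [polar_top]
    rcases eq_or_ne z.1.1 0 with h | h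
    · simp [h, hγ0]
    · simp [ofDirection, energyDensity, pos_iff_ne_zero, h]
  · lift r to ℝ≥0 using hr
    have hk : 0 ≤ kappa γ / (γ - 1) := by unfold kappa; positivity
    rw [polar_coe, energyDensity_ofState hγ, ← ENNReal.coe_mul,
      ← ENNReal.ofReal_coe_nnreal, ENNReal.ofReal_rpow_of_nonneg NNReal.zero_le_coe hγ0.le,
      ← ENNReal.ofReal_mul hk]
    exact ENNReal.ofReal_le_ofReal (le_add_of_nonneg_left (by positivity))

/-- In polar coordinates the energy density is continuous except at the two vertical directions at
infinity. -/
lemma continuousAt_energyDensity_polar {γ : ℝ} (hγ : 1 < γ) {r : ℝ≥0∞} {z : HalfCircle}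
    (h : r ≠ ⊤ ∨ z.1.1 ≠ 0) : ContinuousAt (fun p => energyDensity γ (polar p)) (r, z) := by
  by_cases hr : r = ⊤
  · subst hr
    have hz : (z.1.1 : ℝ≥0∞) ≠ 0 := by simpa using h
    have hγ0 : 0 < γ := by linarith
    have hk : ENNReal.ofReal (kappa γ / (γ - 1)) ≠ 0 := by
      have : 0 < γ - 1 := by linarith
      rw [Ne, ENNReal.ofReal_eq_zero, not_le, kappa]
      positivity
    have h1 : Tendsto (fun p : ℝ≥0∞ × HalfCircle => p.1 * (p.2.1.1 : ℝ≥0∞)) (𝓝 (⊤, z))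
        (𝓝 (⊤ * z.1.1)) := by
      refine ENNReal.Tendsto.mul (continuous_fst.tendsto (⊤, z)) (Or.inl ENNReal.top_ne_zero)
        (Continuous.tendsto (f := fun p : ℝ≥0∞ × HalfCircle => (p.2.1.1 : ℝ≥0∞)) ?_ (⊤, z))
        (Or.inl hz)
      exact ENNReal.continuous_coe.comp (by fun_prop)
    have h2 := ENNReal.Tendsto.const_mul (((ENNReal.continuous_rpow_const (y := γ)).tendsto _).comp h1)
      (Or.inr ENNReal.ofReal_ne_top) (a := ENNReal.ofReal (kappa γ / (γ - 1)))
    rw [ENNReal.top_mul hz, ENNReal.top_rpow_of_pos hγ0, ENNReal.mul_top hk] at h2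
    have h3 : energyDensity γ (polar (⊤, z)) = ⊤ := by
      rw [polar_top]
      simp [ofDirection, energyDensity, pos_iff_ne_zero, by simpa using hz]
    rw [ContinuousAt, h3]
    exact tendsto_nhds_top_mono h2
      (Eventually.of_forall fun p => le_energyDensity_polar hγ p.1 p.2)
  · refine ((continuous_energyDensity_ofState hγ).continuousAt.comp
      (continuousAt_ray r hr z)).congr ?_
    filter_upwards [polar_eventuallyEq_ofState r hr z] with p hp
    rw [hp]
    rfl

/-- The minorant `min (η_E, n ρ / (1 + |(ρ, u)|))` of the energy density.  In contrast to `η_E` it is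
continuous at `vac`, and it is bounded. -/
def energyTrunc (γ : ℝ) (n : ℕ) (p : HBar) : ℝ≥0∞ :=
  min (energyDensity γ p) (n * ENNReal.ofReal (densityCoord.eval p))

lemma continuous_energyTrunc {γ : ℝ} (hγ : 1 < γ) (n : ℕ) : Continuous (energyTrunc γ n) := by
  have hb : Continuous fun p => (n : ℝ≥0∞) * ENNReal.ofReal (densityCoord.eval (polar p)) :=
    (ENNReal.continuous_const_mul (ENNReal.natCast_ne_top n)).comp
      (ENNReal.continuous_ofReal.comp (densityCoord.continuous_eval.comp continuous_polar))
  rw [isQuotientMap_polar.continuous_iff, continuous_iff_continuousAt]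
  rintro ⟨r, z⟩
  by_cases h : r ≠ ⊤ ∨ z.1.1 ≠ 0
  · exact (continuousAt_energyDensity_polar hγ h).min hb.continuousAt
  · -- at `vac` the second member of the minimum tends to zero
    obtain ⟨rfl, hz⟩ : r = ⊤ ∧ z.1.1 = 0 := by simpa [not_or] using h
    have h0 : polar (⊤, z) = .vac := by simp [polar_top, ofDirection, hz]
    have h1 : (n : ℝ≥0∞) * ENNReal.ofReal (densityCoord.eval (polar (⊤, z))) = 0 := by
      simp [h0, densityCoord, CbH.eval_ofDisc, disc]
    have h2 := hb.tendsto (⊤, z)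
    rw [h1] at h2
    have h3 : (energyTrunc γ n ∘ polar) (⊤, z) = 0 := by simp [energyTrunc, h0, energyDensity]
    rw [ContinuousAt, h3]
    exact tendsto_of_tendsto_of_tendsto_of_le_of_le tendsto_const_nhds h2
      (fun _ => zero_le) fun p => min_le_right _ _

lemma monotone_energyTrunc (γ : ℝ) (p : HBar) : Monotone fun n => energyTrunc γ n p :=
  fun _ _ h => min_le_min_left _ (by gcongr)

lemma iSup_energyTrunc (γ : ℝ) (p : HBar) : ⨆ n, energyTrunc γ n p = energyDensity γ p := by
  by_cases hp : p = .vac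
  · simp [hp, energyTrunc, energyDensity]
  · have h : 0 < densityCoord.eval p := by
      rw [densityCoord, CbH.eval_ofDisc]; exact disc_fst_pos hp
    have h1 : ⨆ n : ℕ, (n : ℝ≥0∞) * ENNReal.ofReal (densityCoord.eval p) = ⊤ := by
      rw [← ENNReal.iSup_mul, ENNReal.iSup_natCast, ENNReal.top_mul]
      simpa using h
    simp only [energyTrunc]
    rw [← inf_iSup_eq, h1, inf_top_eq]

lemma energyTrunc_ne_top (γ : ℝ) (n : ℕ) (p : HBar) : energyTrunc γ n p ≠ ⊤ :=
  ne_top_of_le_ne_top (ENNReal.mul_ne_top (ENNReal.natCast_ne_top n) ENNReal.ofReal_ne_top)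
    (min_le_right _ _)

/-- The continuous minorant `energyTrunc γ n` as a test function. -/
def energyTest {γ : ℝ} (hγ : 1 < γ) (n : ℕ) : CbH :=
  CbH.ofContinuous (fun p => (energyTrunc γ n p).toReal)
    (ENNReal.continuousOn_toReal.comp_continuous (continuous_energyTrunc hγ n)
      (energyTrunc_ne_top γ n))

lemma ofReal_eval_energyTest {γ : ℝ} (hγ : 1 < γ) (n : ℕ) (p : HBar) :
    ENNReal.ofReal ((energyTest hγ n).eval p) = energyTrunc γ n p := by
  rw [energyTest, CbH.eval_ofContinuous, ENNReal.ofReal_toReal (energyTrunc_ne_top γ n p)]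

lemma energyTest_nonneg {γ : ℝ} (hγ : 1 < γ) (n : ℕ) (p : HBar) :
    0 ≤ (energyTest hγ n).eval p := by
  rw [energyTest, CbH.eval_ofContinuous]; exact ENNReal.toReal_nonneg

/-! ### Young measures as Markov kernels -/

/-- Testing with the class `C_b(H̄)` controls all Borel sets. -/
lemma YoungMap.measurable_toMeasure {L : ℝ} (ν : YoungMap L) :
    Measurable fun z => (ν.toFun z : Measure HBar) := by
  refine Measurable.measure_of_isPiSystem_of_isProbabilityMeasure
    (BorelSpace.measurable_eq.trans borel_eq_generateFrom_isClosed) isPiSystem_isClosed ?_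
  intro F (hF : IsClosed F)
  refine measurable_of_tendsto_metrizable (fun n => ?_) (tendsto_pi_nhds.2 fun z =>
    HasOuterApproxClosed.tendsto_lintegral_apprSeq hF (ν.toFun z : Measure HBar))
  have hc : Continuous fun p => (hF.apprSeq n p : ℝ) :=
    NNReal.continuous_coe.comp (hF.apprSeq n).continuous
  have h := (ν.measurable_pairing (CbH.ofContinuous _ hc)).ennreal_ofReal
  simp only [CbH.eval_ofContinuous] at h
  convert! h using 2 with z
  rw [ofReal_integral_eq_lintegral_ofReal _ (Eventually.of_forall fun _ => NNReal.coe_nonneg _)]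
  · simp only [ENNReal.ofReal_coe_nnreal]
  · exact (BoundedContinuousFunction.mkOfCompact ⟨_, hc⟩).integrable _

/-- A Young measure as a Markov kernel. -/
def YoungMap.kernel {L : ℝ} (ν : YoungMap L) : Kernel (SpaceTime L) HBar where
  toFun z := ν.toFun z
  measurable' := ν.measurable_toMeasure

instance {L : ℝ} (ν : YoungMap L) : IsMarkovKernel ν.kernel := ⟨fun z => (ν.toFun z).2⟩

/-- A Markov kernel as a Young measure. -/
def YoungMap.ofKernel {L : ℝ} (κ : Kernel (SpaceTime L) HBar) [IsMarkovKernel κ] : YoungMap L where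
  toFun z := ⟨κ z, inferInstance⟩
  measurable_pairing φ := φ.continuous_eval.stronglyMeasurable.integral_kernel.measurable

/-! ### A finite reference measure on space-time -/

section Reference

lemma measurableEmbedding_coe : MeasurableEmbedding ((↑) : ℝ≥0 → ℝ) :=
  MeasurableEmbedding.subtype_coe measurableSet_Ici

/-- The density `exp (-t) / L`, which makes Lebesgue measure on space-time a probability
measure. -/
def weight (L : ℝ) (z : SpaceTime L) : ℝ≥0 := Real.toNNReal (Real.exp (-z.1) / L)

variable (L : ℝ)

lemma continuous_weight : Continuous (weight L) := by unfold weight; fun_prop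

variable [Fact (0 < L)]

lemma weight_pos (z : SpaceTime L) : 0 < weight L z :=
  Real.toNNReal_pos.2 (div_pos (Real.exp_pos _) (Fact.out : 0 < L))

/-- The probability measure `exp (-t) / L dt dx`. -/
def reference : Measure (SpaceTime L) := (lam L).withDensity fun z => weight L z

instance : IsProbabilityMeasure (reference L) := by
  have hL : 0 < L := Fact.out
  constructor
  have h1 : ∫⁻ t : ℝ≥0, ENNReal.ofReal (Real.exp (-t))
      ∂(Measure.comap ((↑) : ℝ≥0 → ℝ) volume) = 1 := by
    rw [← measurableEmbedding_coe.lintegral_map (fun t : ℝ => ENNReal.ofReal (Real.exp (-t))),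
      measurableEmbedding_coe.map_comap, ← ofReal_integral_eq_lintegral_ofReal]
    · have : Set.range ((↑) : ℝ≥0 → ℝ) = Set.Ici 0 := Subtype.range_coe
      rw [this, integral_Ici_eq_integral_Ioi, integral_exp_neg_Ioi_zero, ENNReal.ofReal_one]
    · have : Set.range ((↑) : ℝ≥0 → ℝ) = Set.Ici 0 := Subtype.range_coe
      rw [this]
      exact (integrableOn_Ici_iff_integrableOn_Ioi (by simp)).2 (integrableOn_exp_neg_Ioi 0)
    · exact Eventually.of_forall fun t => (Real.exp_pos _).le
  have h2 (z : SpaceTime L) : (weight L z : ℝ≥0∞) =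
      ENNReal.ofReal (Real.exp (-z.1)) * ENNReal.ofReal L⁻¹ := by
    rw [weight, div_eq_mul_inv, ← ENNReal.ofReal_mul (Real.exp_pos _).le]; rfl
  rw [reference, withDensity_apply _ MeasurableSet.univ, Measure.restrict_univ, lam]
  simp only [h2]
  rw [lintegral_prod_mul (f := fun t : ℝ≥0 => ENNReal.ofReal (Real.exp (-t)))
    (g := fun _ => ENNReal.ofReal L⁻¹) (by fun_prop) (by fun_prop), h1, lintegral_const,
    AddCircle.measure_univ, one_mul, ← ENNReal.ofReal_mul (by positivity),
    inv_mul_cancel₀ hL.ne', ENNReal.ofReal_one]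

lemma lam_absolutelyContinuous_reference : lam L ≪ reference L :=
  withDensity_absolutelyContinuous'
    (continuous_weight L).measurable.coe_nnreal_ennreal.aemeasurable
    (Eventually.of_forall fun z => ENNReal.coe_ne_zero.2 (weight_pos L z).ne')

/-- A single time is negligible in space-time. -/
lemma lam_setOf_time_eq (t : ℝ≥0) : lam L {z | z.1 = t} = 0 := by
  have h : {z : SpaceTime L | z.1 = t} = {t} ×ˢ Set.univ := by ext; simp
  rw [h, lam, Measure.prod_prod, measurableEmbedding_coe.comap_apply]
  simp

end Reference

variable {L : ℝ}

/-! ### Test functions on space-time -/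

lemma IsTest.continuous {ψ : SpaceTime L → ℝ} (hψ : IsTest ψ) : Continuous ψ := by
  have hq : IsOpenQuotientMap
      (Prod.map id ((↑) : ℝ → AddCircle L) : ℝ≥0 × ℝ → SpaceTime L) :=
    IsOpenQuotientMap.id.prodMap QuotientAddGroup.isOpenQuotientMap_mk
  rw [hq.isQuotientMap.continuous_iff]
  have h := hψ.2.continuousOn.comp_continuous
    (f := fun p : ℝ≥0 × ℝ => ((p.1 : ℝ), p.2)) (by fun_prop) (by simp)
  simpa [Function.comp_def, Prod.map] using h

lemma IsTest.hasCompactSupport_div_weight {ψ : SpaceTime L → ℝ} (hψ : IsTest ψ) :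
    HasCompactSupport fun z => ψ z / weight L z := by
  simpa only [div_eq_mul_inv] using! hψ.1.mul_right (f' := fun z => (weight L z : ℝ)⁻¹)

variable [Fact (0 < L)]

lemma IsTest.continuous_div_weight {ψ : SpaceTime L → ℝ} (hψ : IsTest ψ) :
    Continuous fun z => ψ z / weight L z :=
  hψ.continuous.div (NNReal.continuous_coe.comp (continuous_weight L))
    fun z => NNReal.coe_ne_zero.2 (weight_pos L z).ne'

/-- The function `ψ(t, x) φ(p)`, divided by the density of the reference measure, as a bounded
continuous function. -/
def tensorTest (ψ : SpaceTime L → ℝ) (hψ : IsTest ψ) (φ : CbH) : SpaceTime L × HBar →ᵇ ℝ :=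
  (BoundedContinuousFunction.ofNormedAddCommGroup (fun z => ψ z / weight L z)
      hψ.continuous_div_weight _
      (hψ.hasCompactSupport_div_weight.exists_bound_of_continuous
        hψ.continuous_div_weight).choose_spec).compContinuous ⟨Prod.fst, continuous_fst⟩ *
    (BoundedContinuousFunction.mkOfCompact ⟨φ.eval, φ.continuous_eval⟩).compContinuous
      ⟨Prod.snd, continuous_snd⟩

lemma tensorTest_apply (ψ : SpaceTime L → ℝ) (hψ : IsTest ψ) (φ : CbH) (z : SpaceTime L)
    (p : HBar) : tensorTest ψ hψ φ (z, p) = ψ z / weight L z * φ.eval p := rfl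

lemma integral_reference (f : SpaceTime L → ℝ) :
    ∫ z, f z / weight L z ∂reference L = ∫ z, f z ∂lam L := by
  rw [reference, integral_withDensity_eq_integral_smul (continuous_weight L).measurable]
  refine integral_congr_ae (Eventually.of_forall fun z => ?_)
  exact mul_div_cancel₀ _ (NNReal.coe_ne_zero.2 (weight_pos L z).ne')

/-! ### Young measures as measures with a fixed marginal -/

variable (L) in
/-- The probability measures on `[0, ∞) × 𝕋 × H̄` whose marginal on space-time is the reference
measure. -/
def fixedMarginal : Set (ProbabilityMeasure (SpaceTime L × HBar)) :=
  {M | (M : Measure (SpaceTime L × HBar)).fst = reference L}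

variable (L) in
lemma isClosed_fixedMarginal : IsClosed (fixedMarginal L) := by
  have h : fixedMarginal L = (fun M : ProbabilityMeasure (SpaceTime L × HBar) =>
      M.map continuous_fst.measurable.aemeasurable) ⁻¹' {⟨reference L, inferInstance⟩} := by
    ext M
    exact ⟨fun h => Subtype.ext h, fun h => congrArg Subtype.val h⟩
  rw [h]
  exact isClosed_singleton.preimage (ProbabilityMeasure.continuous_map continuous_fst)

variable (L) in
/-- Since `H̄` is compact, only the fixed marginal matters for tightness. -/
lemma isCompact_fixedMarginal : IsCompact (fixedMarginal L) := by
  rw [← (isClosed_fixedMarginal L).closure_eq]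
  refine isCompact_closure_of_isTightMeasureSet ?_
  rw [isTightMeasureSet_iff_exists_isCompact_measure_compl_le]
  intro ε hε
  obtain ⟨K, hK, hKε⟩ := isTightMeasureSet_iff_exists_isCompact_measure_compl_le.1
    (isTightMeasureSet_singleton (μ := reference L)) ε hε
  refine ⟨K ×ˢ Set.univ, hK.prod isCompact_univ, ?_⟩
  rintro _ ⟨M, hM, rfl⟩
  have h : (K ×ˢ (Set.univ : Set HBar))ᶜ = Prod.fst ⁻¹' Kᶜ := by ext; simp
  rw [h, ← Measure.fst_apply hK.measurableSet.compl, hM]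
  exact hKε _ rfl

/-- Disintegration of a measure with respect to space-time. -/
def disintegration (M : fixedMarginal L) : YoungMeasure L :=
  ⟦YoungMap.ofKernel (M.1 : Measure (SpaceTime L × HBar)).condKernel⟧

lemma pairing_disintegration (ψ : SpaceTime L → ℝ) (hψ : IsTest ψ) (φ : CbH)
    (M : fixedMarginal L) : (disintegration M).pairing ψ φ =
      ∫ x, tensorTest ψ hψ φ x ∂(M.1 : Measure (SpaceTime L × HBar)) := by
  have hM : (M.1 : Measure (SpaceTime L × HBar)).fst = reference L := M.2
  rw [← Measure.integral_condKernel ((tensorTest ψ hψ φ).integrable _), hM]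
  simp only [tensorTest_apply, integral_const_mul]
  simp only [div_mul_eq_mul_div]
  rw [integral_reference]
  rfl

lemma continuous_disintegration : Continuous (disintegration (L := L)) := by
  refine continuous_iInf_rng.2 fun ψ => continuous_iInf_rng.2 fun φ => continuous_induced_rng.2 ?_
  have h : YoungMeasure.pairing ψ.1 φ ∘ disintegration =
      fun M : fixedMarginal L => ∫ x, tensorTest ψ.1 ψ.2 φ x ∂(M.1 : Measure _) :=
    funext fun M => pairing_disintegration ψ.1 ψ.2 φ M
  rw [h]
  exact (ProbabilityMeasure.continuous_integral_boundedContinuousFunction _).comp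
    continuous_subtype_val

/-- Every Young measure disintegrates its own composition product with the reference measure, since
conditional kernels are unique almost everywhere and Lebesgue measure is absolutely continuous with
respect to the reference measure. -/
lemma surjective_disintegration : Function.Surjective (disintegration (L := L)) := by
  rintro ⟨ν⟩
  have hfst : (reference L ⊗ₘ ν.kernel).fst = reference L := Measure.fst_compProd _ _
  refine ⟨⟨⟨reference L ⊗ₘ ν.kernel, inferInstance⟩, hfst⟩, Quotient.sound ?_⟩
  have h := eq_condKernel_of_measure_eq_compProd (ρ := reference L ⊗ₘ ν.kernel) ν.kernel
    (by rw [hfst])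
  rw [hfst] at h
  filter_upwards [lam_absolutelyContinuous_reference L h] with z hz
  exact Subtype.ext hz.symm

instance : CompactSpace (YoungMeasure L) := by
  have := isCompact_iff_compactSpace.1 (isCompact_fixedMarginal L)
  exact ⟨by simpa [surjective_disintegration.range_eq] using
    isCompact_range (continuous_disintegration (L := L))⟩

/-! ### Lower semicontinuity of the energy -/

/-- Smooth functions of time that increase to the indicator function of `[0, m)`. -/
def cutoff (L : ℝ) (m n : ℕ) (z : SpaceTime L) : ℝ := Real.smoothTransition (n * (m - z.1))

lemma cutoff_nonneg (L : ℝ) (m n : ℕ) (z : SpaceTime L) : 0 ≤ cutoff L m n z :=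
  Real.smoothTransition.nonneg _

lemma cutoff_of_le (L : ℝ) {m : ℕ} (n : ℕ) {z : SpaceTime L} (h : (m : ℝ≥0) ≤ z.1) :
    cutoff L m n z = 0 := by
  have h' : (m : ℝ) ≤ z.1 := by exact_mod_cast h
  exact Real.smoothTransition.zero_of_nonpos
    (mul_nonpos_of_nonneg_of_nonpos n.cast_nonneg (by linarith))

lemma monotone_cutoff (L : ℝ) (m : ℕ) (z : SpaceTime L) : Monotone fun n => cutoff L m n z := by
  intro a b hab
  rcases le_total (m : ℝ≥0) z.1 with h | h
  · simp [cutoff_of_le L _ h]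
  · have h' : (z.1 : ℝ) ≤ m := by exact_mod_cast h
    exact Real.smoothTransition.monotone
      (mul_le_mul_of_nonneg_right (Nat.cast_le.2 hab) (by linarith))

lemma iSup_cutoff (L : ℝ) {m : ℕ} {z : SpaceTime L} (h : z.1 < m) :
    ⨆ n, ENNReal.ofReal (cutoff L m n z) = 1 := by
  refine le_antisymm (iSup_le fun n => ?_) ?_
  · exact ENNReal.ofReal_le_one.2 (Real.smoothTransition.le_one _)
  · have h' : (0 : ℝ) < m - z.1 := sub_pos.2 (by exact_mod_cast h)
    obtain ⟨n, hn⟩ := exists_nat_ge ((m - z.1 : ℝ)⁻¹)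
    refine le_iSup_of_le n ?_
    rw [cutoff, Real.smoothTransition.one_of_one_le, ENNReal.ofReal_one]
    calc (1 : ℝ) = (m - z.1 : ℝ)⁻¹ * (m - z.1) := (inv_mul_cancel₀ h'.ne').symm
      _ ≤ _ := mul_le_mul_of_nonneg_right hn h'.le

variable (L : ℝ) [Fact (0 < L)]

lemma isTest_cutoff (m n : ℕ) : IsTest (cutoff L m n) := by
  constructor
  · refine HasCompactSupport.intro (K := Set.Icc 0 (m : ℝ≥0) ×ˢ Set.univ)
      (isCompact_Icc.prod isCompact_univ) fun z hz => cutoff_of_le L n ?_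
    by_contra h
    exact hz ⟨⟨zero_le, (not_le.1 h).le⟩, trivial⟩
  · have h : ContDiff ℝ ∞ fun p : ℝ × ℝ => Real.smoothTransition (n * (m - p.1)) :=
      Real.smoothTransition.contDiff.comp (by fun_prop)
    refine h.contDiffOn.congr fun p hp => ?_
    rw [cutoff, Real.coe_toNNReal _ hp.1]

variable {L}

lemma YoungMap.integrable_pairing (ν : YoungMap L) {ψ : SpaceTime L → ℝ} (hψ : IsTest ψ)
    (φ : CbH) :
    Integrable (fun z => ψ z * ∫ p, φ.eval p ∂(ν.toFun z : Measure HBar)) (lam L) := by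
  have h : Integrable (fun z => ∫ p, tensorTest ψ hψ φ (z, p) ∂(ν.kernel z)) (reference L) :=
    Integrable.integral_compProd (κ := Kernel.const Unit (reference L))
      (η := Kernel.prodMkLeft Unit ν.kernel) (a := ())
      ((tensorTest ψ hψ φ).integrable (reference L ⊗ₘ ν.kernel))
  simp only [tensorTest_apply, integral_const_mul] at h
  rw [reference, integrable_withDensity_iff_integrable_smul (continuous_weight L).measurable] at h
  refine h.congr (Eventually.of_forall fun z => ?_)
  change (weight L z : ℝ) * (ψ z / weight L z * _) = _
  rw [← mul_assoc, mul_div_cancel₀ _ (NNReal.coe_ne_zero.2 (weight_pos L z).ne')]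
  rfl

/-- Pairings with the cutoffs and the minorants of the energy density, as integrals in `[0, ∞]`. -/
lemma YoungMap.ofReal_pairing {γ : ℝ} (hγ : 1 < γ) (m n : ℕ) (ν : YoungMap L) :
    ENNReal.ofReal (YoungMeasure.pairing (cutoff L m n) (energyTest hγ n) ⟦ν⟧) =
      ∫⁻ z, ENNReal.ofReal (cutoff L m n z) *
        ∫⁻ p, energyTrunc γ n p ∂(ν.toFun z : Measure HBar) ∂(lam L) := by
  change ENNReal.ofReal (∫ z, _ ∂(lam L)) = _
  rw [ofReal_integral_eq_lintegral_ofReal (ν.integrable_pairing (isTest_cutoff L m n) _)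
    (Eventually.of_forall fun z => mul_nonneg (cutoff_nonneg L m n z)
      (integral_nonneg (energyTest_nonneg hγ n)))]
  refine lintegral_congr fun z => ?_
  have hint : Integrable (energyTest hγ n).eval (ν.toFun z : Measure HBar) :=
    (BoundedContinuousFunction.mkOfCompact ⟨_, (energyTest hγ n).continuous_eval⟩).integrable _
  rw [ENNReal.ofReal_mul (cutoff_nonneg L m n z), ofReal_integral_eq_lintegral_ofReal hint
    (Eventually.of_forall (energyTest_nonneg hγ n))]
  congr 1
  exact lintegral_congr fun p => ofReal_eval_energyTest hγ n p

lemma iSup_mul_of_monotone {a b : ℕ → ℝ≥0∞} (ha : Monotone a) (hb : Monotone b) :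
    ⨆ n, a n * b n = (⨆ n, a n) * ⨆ n, b n := by
  rw [ENNReal.iSup_mul]
  simp only [ENNReal.mul_iSup]
  refine le_antisymm (iSup_le fun n => le_iSup₂_of_le n n le_rfl) (iSup₂_le fun i j => ?_)
  exact le_iSup_of_le (max i j) (mul_le_mul' (ha (le_max_left i j)) (hb (le_max_right i j)))

/-- The energy is a supremum of pairings with test functions.  The closed time interval in the
energy may be replaced by a half-open one, since a single time is negligible. -/
lemma YoungMeasure.energy_eq_iSup {γ : ℝ} (hγ : 1 < γ) (m : ℕ) (ν : YoungMeasure L) :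
    ν.energy γ m =
      ⨆ n, ENNReal.ofReal (YoungMeasure.pairing (cutoff L m n) (energyTest hγ n) ν) := by
  induction ν using Quotient.inductionOn with | _ ν
  have hmeas (n : ℕ) : Measurable fun z : SpaceTime L => ENNReal.ofReal (cutoff L m n z) *
      ∫⁻ p, energyTrunc γ n p ∂(ν.toFun z : Measure HBar) :=
    (isTest_cutoff L m n).continuous.measurable.ennreal_ofReal.mul
      ((continuous_energyTrunc hγ n).measurable.lintegral_kernel (κ := ν.kernel))
  have hmono1 (z : SpaceTime L) : Monotone fun n => ENNReal.ofReal (cutoff L m n z) :=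
    fun a b hab => ENNReal.ofReal_le_ofReal (monotone_cutoff L m z hab)
  have hmono2 (z : SpaceTime L) :
      Monotone fun n => ∫⁻ p, energyTrunc γ n p ∂(ν.toFun z : Measure HBar) :=
    fun a b hab => lintegral_mono fun p => monotone_energyTrunc γ p hab
  have hsup (z : SpaceTime L) :
      ⨆ n, (ENNReal.ofReal (cutoff L m n z) *
        ∫⁻ p, energyTrunc γ n p ∂(ν.toFun z : Measure HBar)) =
      {z : SpaceTime L | z.1 < m}.indicator
        (fun z => ∫⁻ p, energyDensity γ p ∂(ν.toFun z : Measure HBar)) z := by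
    by_cases hz : z.1 < m
    · rw [Set.indicator_of_mem (by exact hz),
        iSup_mul_of_monotone (hmono1 z) (hmono2 z), iSup_cutoff L hz, one_mul,
        ← lintegral_iSup (fun n => (continuous_energyTrunc hγ n).measurable)
          (fun a b hab p => monotone_energyTrunc γ p hab)]
      simp only [iSup_energyTrunc]
    · rw [Set.indicator_of_notMem (by exact hz)]
      simp [cutoff_of_le L _ (not_lt.1 hz)]
  have hset : ({z : SpaceTime L | z.1 ≤ m} : Set _) =ᵐ[lam L] {z | z.1 < m} := by
    have h : ∀ᵐ z ∂(lam L), z.1 ≠ (m : ℝ≥0) := by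
      simpa [ae_iff] using lam_setOf_time_eq L m
    filter_upwards [h] with z hz
    exact propext ⟨fun h => lt_of_le_of_ne h hz, fun h => le_of_lt h⟩
  have hopen : MeasurableSet {z : SpaceTime L | z.1 < m} :=
    measurableSet_lt measurable_fst measurable_const
  change ∫⁻ z in {z : SpaceTime L | z.1 ≤ m}, _ ∂(lam L) = _
  rw [Measure.restrict_congr_set hset, ← lintegral_indicator hopen]
  simp only [YoungMap.ofReal_pairing, ← hsup]
  exact lintegral_iSup hmeas fun a b hab z => mul_le_mul' (hmono1 z hab) (hmono2 z hab)

lemma YoungMeasure.continuous_pairing {ψ : SpaceTime L → ℝ} (hψ : IsTest ψ) (φ : CbH) :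
    Continuous (YoungMeasure.pairing ψ φ) :=
  continuous_iInf_dom (i := ⟨ψ, hψ⟩) (continuous_iInf_dom (i := φ) continuous_induced_dom)

lemma YoungMeasure.lowerSemicontinuous_energy {γ : ℝ} (hγ : 1 < γ) (m : ℕ) :
    LowerSemicontinuous fun ν : YoungMeasure L => ν.energy γ m := by
  simp only [energy_eq_iSup hγ]
  exact lowerSemicontinuous_iSup fun n => (ENNReal.continuous_ofReal.comp
    (continuous_pairing (isTest_cutoff L m n) _)).lowerSemicontinuous

lemma YoungMeasure.isClosed_setOf_energy_le {γ : ℝ} (hγ : 1 < γ) (C : ℕ → ℝ≥0) :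
    IsClosed {ν : YoungMeasure L | ∀ m : ℕ, 1 ≤ m → ν.energy γ m ≤ C m} := by
  simp only [Set.ofPred_forall]
  exact isClosed_iInter fun m => isClosed_iInter fun _ =>
    (lowerSemicontinuous_energy hγ m).isClosed_preimage _

/-! ### Tightness under bounds for the expected energy -/

/-- Chebyshev's inequality for each time horizon `m`, with a share `ε' m` of the admissible
probability `ε`. -/
lemma exists_energy_bound {γ : ℝ} (hγ : 1 < γ) (α : ℕ → ℝ≥0) {ε : ℝ≥0∞} (hε : 0 < ε) :
    ∃ C : ℕ → ℝ≥0, ∀ μ : Measure (YoungMeasure L),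
      (∀ m : ℕ, 1 ≤ m → ∫⁻ ν, ν.energy γ m ∂μ ≤ α m) →
        μ {ν : YoungMeasure L | ∀ m : ℕ, 1 ≤ m → ν.energy γ m ≤ C m}ᶜ ≤ ε := by
  obtain ⟨ε', hε', hsum⟩ := ENNReal.exists_pos_sum_of_countable hε.ne' ℕ
  -- the summand `1` keeps the bound positive when `α m = 0`
  refine ⟨fun m => (α m + 1) / ε' m, fun μ hμ => ?_⟩
  have hbound (m : ℕ) (hm : 1 ≤ m) :
      μ {ν : YoungMeasure L | (((α m + 1) / ε' m : ℝ≥0) : ℝ≥0∞) ≤ ν.energy γ m} ≤ ε' m := by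
    have hC : (((α m + 1) / ε' m : ℝ≥0) : ℝ≥0∞) ≠ 0 :=
      ENNReal.coe_ne_zero.2 (div_pos (by positivity) (hε' m)).ne'
    refine (meas_ge_le_lintegral_div
      (YoungMeasure.lowerSemicontinuous_energy hγ m).measurable.aemeasurable hC
      ENNReal.coe_ne_top).trans (ENNReal.div_le_of_le_mul ((hμ m hm).trans ?_))
    rw [← ENNReal.coe_mul, mul_div_cancel₀ _ (hε' m).ne']
    exact ENNReal.coe_le_coe.2 le_self_add
  have hsub : {ν : YoungMeasure L | ∀ m : ℕ, 1 ≤ m →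
      ν.energy γ m ≤ ((α m + 1) / ε' m : ℝ≥0)}ᶜ ⊆ ⋃ m : ℕ, {ν : YoungMeasure L |
        1 ≤ m ∧ (((α m + 1) / ε' m : ℝ≥0) : ℝ≥0∞) ≤ ν.energy γ m} := by
    intro ν hν
    simp only [Set.mem_compl_iff, Set.mem_ofPred_eq, not_forall, not_le] at hν
    obtain ⟨m, hm, h⟩ := hν
    exact Set.mem_iUnion.2 ⟨m, hm, h.le⟩
  calc _ ≤ _ := measure_mono hsub
    _ ≤ _ := measure_iUnion_le _
    _ ≤ ∑' m, (ε' m : ℝ≥0∞) := by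
        refine ENNReal.tsum_le_tsum fun m => ?_
        by_cases hm : 1 ≤ m
        · simpa only [hm, true_and] using hbound m hm
        · simp [hm]
    _ ≤ ε := hsum.le

end VacuumYoung

end

theorem mainTheorem10 (L : ℝ) [Fact (0 < L)] (γ : ℝ) (hγ : 1 < γ) :
    (∀ C : ℕ → ℝ≥0,
      IsCompact {ν : VacuumYoung.YoungMeasure L | ∀ m : ℕ, 1 ≤ m → ν.energy γ m ≤ C m}) ∧
    (∀ {Ω ι : Type*} [MeasurableSpace Ω] (P : Measure Ω) [IsProbabilityMeasure P]
      (ν : ι → Ω → VacuumYoung.YoungMeasure L), (∀ i, Measurable (ν i)) →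
      ∀ α : ℕ → ℝ≥0,
        (∀ m : ℕ, 1 ≤ m → ∀ i, ∫⁻ x, (ν i x).energy γ m ∂P ≤ α m) →
        IsTightMeasureSet (Set.range fun i => P.map (ν i))) := by
  have hcompact (C : ℕ → ℝ≥0) :
      IsCompact {ν : VacuumYoung.YoungMeasure L | ∀ m : ℕ, 1 ≤ m → ν.energy γ m ≤ C m} :=
    (VacuumYoung.YoungMeasure.isClosed_setOf_energy_le hγ C).isCompact
  refine ⟨hcompact, fun P _ ν hν α hα => ?_⟩
  rw [isTightMeasureSet_iff_exists_isCompact_measure_compl_le]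
  intro ε hε
  obtain ⟨C, hC⟩ := VacuumYoung.exists_energy_bound (L := L) hγ α hε
  refine ⟨_, hcompact C, ?_⟩
  rintro _ ⟨i, rfl⟩
  refine hC _ fun m hm => ?_
  rw [lintegral_map (VacuumYoung.YoungMeasure.lowerSemicontinuous_energy hγ m).measurable (hν i)]
  exact hα m hm i
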